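/- Let $(\breve N,\breve g,\breve P)$ be a locally Golden semi-Riemannian manifold: $\breve g$ is a semi-Riemannian metric with Levi-Civita connection $\breve\nabla$, and $\breve P$ is a smooth $(1,1)$-tensor field with $\breve P^2=\breve P+I$, $\breve g(\breve PX,Y)=\breve g(X,\breve PY)$ and $\breve\nabla\breve P=0$. Let $\acute N$ be a lightlike submanifold immersed in $\breve N$, with induced degenerate metric $g$: the radical $\operatorname{Rad}T\acute N=T\acute N\cap T\acute N^{\perp}$ is a smooth distribution of constant rank $r\ge 1$. Let $S(T\acute N)$ be a screen distribution (a complement of $\operatorname{Rad}T\acute N$ in $T\acute N$), let $S(T\acute N^{\perp})$ be a screen transversal bundle (a complement of $\operatorname{Rad}T\acute N$ in $T\acute N^{\perp}$), and let $\operatorname{ltr}T\acute N$ be a transversal bundle with $$T\breve N|_{\acute N}=S(T\acute N)\perp[\operatorname{Rad}T\acute N\oplus \operatorname{ltr}T\acute N]\perp S(T\acute N^{\perp}),\qquad \operatorname{tr}T\acute N=\operatorname{ltr}T\acute N\perp S(T\acute N^{\perp})$$ (all these bundles are smooth; $\operatorname{ltr}T\acute N$ is not required to be totally null). For $W,U\in\Gamma(T\acute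 N)$ and $V\in\Gamma(\operatorname{ltr}T\acute N)$ let $\nabla_WU$ be the $T\acute N$-component of $\breve\nabla_WU$ in $T\breve N|_{\acute N}=T\acute N\oplus\operatorname{tr}T\acute N$ (the induced connection), and let $h^s(W,U)$ and $D^s(W,V)$ be the $S(T\acute N^{\perp})$-components of $\breve\nabla_WU$ and $\breve\nabla_WV$. Suppose that $\acute N$ is a transversal lightlike submanifold, i.e. $\breve P(\operatorname{Rad}T\acute N)=\operatorname{ltr}T\acute N$ and $\breve P(S(T\acute N))\subseteq S(T\acute N^{\perp})$. Then the induced connection $\nabla$ is a metric connection ($\nabla g=0$) if and only if $$Q_1\breve P D^s(W,\breve P\xi)=M_1\breve P h^s(W,\xi)\qquad\text{for all }W\in\Gamma(T\acute N),\ \xi\in\Gamma(\operatorname{Rad}T\acute N),$$ where $Q_1$ and $M_1$ both denote the projection onto $S(T\acute N)$ along $\operatorname{Rad}T\acute N\oplus\operatorname{ltr}T\acute N\oplus S(T\acute N^{\perp})$. -/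

import Mathlib

open scoped Manifold ContDiff

noncomputable section

namespace GoldenLightlike

/-! Throughout, `M` (the ambient manifold) and `N` (the submanifold) are smooth finite-dimensional
manifolds without boundary, modelled on the real vector spaces `E` and `F`. -/

section Ambient

variable {E : Type*} [NormedAddCommGroup E] [NormedSpace ℝ E]
  {M : Type*} [TopologicalSpace M] [ChartedSpace E M]

/-- A semi-Riemannian metric: a smooth symmetric nondegenerate `(0,2)`-tensor field. Its index is
then locally constant; it is not required to be the same on all connected components. -/
structure SemiRiemannianMetric (E : Type*) [NormedAddCommGroup E] [NormedSpace ℝ E]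
    (M : Type*) [TopologicalSpace M] [ChartedSpace E M] [IsManifold 𝓘(ℝ, E) ∞ M] where
  /-- The scalar product on each tangent space. -/
  inner (p : M) : TangentSpace 𝓘(ℝ, E) p →L[ℝ] TangentSpace 𝓘(ℝ, E) p →L[ℝ] ℝ
  symm (p : M) (v w : TangentSpace 𝓘(ℝ, E) p) : inner p v w = inner p w v
  nondegenerate (p : M) (v : TangentSpace 𝓘(ℝ, E) p) (hv : ∀ w, inner p v w = 0) : v = 0
  contMDiff : ContMDiff 𝓘(ℝ, E) (𝓘(ℝ, E).prod 𝓘(ℝ, E →L[ℝ] E →L[ℝ] ℝ)) ∞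
    (fun p : M ↦ Bundle.TotalSpace.mk' (E →L[ℝ] E →L[ℝ] ℝ) p (inner p))

/-- Smoothness of a vector field `V` along a map `f : N → M`, i.e. of a section of `f^* TM`.
For `f = id` this is smoothness of an ordinary vector field. -/
def SmoothAlong {F : Type*} [NormedAddCommGroup F] [NormedSpace ℝ F]
    {N : Type*} [TopologicalSpace N] [ChartedSpace F N] [IsManifold 𝓘(ℝ, E) ∞ M]
    (f : N → M) (V : ∀ x : N, TangentSpace 𝓘(ℝ, E) (f x)) : Prop :=
  ContMDiff 𝓘(ℝ, F) 𝓘(ℝ, E).tangent ∞ (fun x ↦ (⟨f x, V x⟩ : TangentBundle 𝓘(ℝ, E) M))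

/-- `W` is a smooth vector field on `N`. -/
abbrev SmoothField {F : Type*} [NormedAddCommGroup F] [NormedSpace ℝ F]
    {N : Type*} [TopologicalSpace N] [ChartedSpace F N] [IsManifold 𝓘(ℝ, F) ∞ N]
    (W : ∀ x : N, TangentSpace 𝓘(ℝ, F) x) : Prop :=
  SmoothAlong (E := F) (F := F) (fun x : N ↦ x) W

/-- `D` is a smooth vector subbundle of `f^* TM`: it has constant rank, and each of its vectors
is the value of a smooth section of `D`. For `f = id` this is a smooth distribution. -/
structure IsSmoothSubbundle {F : Type*} [NormedAddCommGroup F] [NormedSpace ℝ F]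
    {N : Type*} [TopologicalSpace N] [ChartedSpace F N] [IsManifold 𝓘(ℝ, E) ∞ M]
    (f : N → M) (D : ∀ x : N, Submodule ℝ (TangentSpace 𝓘(ℝ, E) (f x))) : Prop where
  rank : ∃ k : ℕ, ∀ x, Module.finrank ℝ (D x) = k
  exists_section : ∀ x, ∀ v ∈ D x, ∃ V : ∀ y : N, TangentSpace 𝓘(ℝ, E) (f y),
    SmoothAlong (F := F) f V ∧ (∀ y, V y ∈ D y) ∧ V x = v

variable [FiniteDimensional ℝ E] [IsManifold 𝓘(ℝ, E) ∞ M]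

instance (p : M) : FiniteDimensional ℝ (TangentSpace 𝓘(ℝ, E) p) :=
  inferInstanceAs (FiniteDimensional ℝ E)

namespace SemiRiemannianMetric

variable (g : SemiRiemannianMetric E M)

/-- The metric at `p` as a bilinear form. -/
def bilin (p : M) : LinearMap.BilinForm ℝ (TangentSpace 𝓘(ℝ, E) p) :=
  LinearMap.mk₂ ℝ (fun v w ↦ g.inner p v w) (by simp) (by simp) (by simp) (by simp)

lemma bilin_nondegenerate (p : M) : (g.bilin p).Nondegenerate :=
  ⟨fun v hv ↦ g.nondegenerate p v hv,
    fun v hv ↦ g.nondegenerate p v fun w ↦ (g.symm p v w).trans (hv w)⟩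

/-- The coordinate matrix of the metric in the preferred chart at `p`, as a function on `M` (it is
meaningful near `p`): `gram p y u v = g_y (u^i ∂_i, v^j ∂_j)`. -/
def gram (p y : M) : E →L[ℝ] E →L[ℝ] ℝ :=
  (ContinuousLinearMap.precomp ℝ ((trivializationAt E (TangentSpace 𝓘(ℝ, E)) p).symmL ℝ y)) ∘L
    (g.inner y) ∘L ((trivializationAt E (TangentSpace 𝓘(ℝ, E)) p).symmL ℝ y)

/-- The Christoffel symbols of the first kind at `p` in the preferred chart at `p`:
`Γ(u, v, w) = (∂_u g(v, w) + ∂_v g(u, w) - ∂_w g(u, v)) / 2`, as a linear form in `w`. -/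
def christoffelFirst (p : M) (u v : TangentSpace 𝓘(ℝ, E) p) :
    Module.Dual ℝ (TangentSpace 𝓘(ℝ, E) p) where
  toFun w :=
    let c := (trivializationAt E (TangentSpace 𝓘(ℝ, E)) p).continuousLinearMapAt ℝ p
    let dg := mvfderiv 𝓘(ℝ, E) (g.gram p) p
    (dg u (c v) (c w) + dg v (c u) (c w) - dg w (c u) (c v)) / 2
  map_add' w w' := by simp; ring
  map_smul' a w := by simp; ring

/-- The Christoffel symbols (of the second kind) at `p` in the preferred chart at `p`:
`g_p (Γ(u, v), w) = Γ(u, v, w)` for all `w`. -/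
def christoffel (p : M) (u v : TangentSpace 𝓘(ℝ, E) p) : TangentSpace 𝓘(ℝ, E) p :=
  ((g.bilin p).toDual (g.bilin_nondegenerate p)).symm (g.christoffelFirst p u v)

variable {F : Type*} [NormedAddCommGroup F] [NormedSpace ℝ F]
  {N : Type*} [TopologicalSpace N] [ChartedSpace F N]

/-- The covariant derivative `∇̆_w V` at `x`, with respect to the Levi-Civita connection `∇̆` of `g`,
of a vector field `V` along `f : N → M`. In the preferred chart at `f x` it is
`dV(w) + Γ(df w, V)`. For `f = id` this is the Levi-Civita connection itself. -/
def leviCivita (f : N → M) (V : ∀ x : N, TangentSpace 𝓘(ℝ, E) (f x)) (x : N)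
    (w : TangentSpace 𝓘(ℝ, F) x) : TangentSpace 𝓘(ℝ, E) (f x) :=
  let e := trivializationAt E (TangentSpace 𝓘(ℝ, E)) (f x)
  e.symmL ℝ (f x) (mvfderiv 𝓘(ℝ, F)
      (fun y ↦ (e (⟨f y, V y⟩ : TangentBundle 𝓘(ℝ, E) M)).2) x w)
    + g.christoffel (f x) (mfderiv 𝓘(ℝ, F) 𝓘(ℝ, E) f x w) (V x)

end SemiRiemannianMetric

/-- A Golden structure on `(M, g)`: a smooth `(1,1)`-tensor field `P` with `P² = P + I`, such that
`g` is `P`-compatible. With it `(M, g, P)` is a Golden semi-Riemannian manifold. -/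
structure GoldenStructure (g : SemiRiemannianMetric E M) where
  /-- The endomorphism of each tangent space. -/
  P (p : M) : TangentSpace 𝓘(ℝ, E) p →L[ℝ] TangentSpace 𝓘(ℝ, E) p
  golden (p : M) (v : TangentSpace 𝓘(ℝ, E) p) : P p (P p v) = P p v + v
  compatible (p : M) (v w : TangentSpace 𝓘(ℝ, E) p) : g.inner p (P p v) w = g.inner p v (P p w)
  contMDiff : ContMDiff 𝓘(ℝ, E) (𝓘(ℝ, E).prod 𝓘(ℝ, E →L[ℝ] E)) ∞
    (fun p : M ↦ Bundle.TotalSpace.mk' (E →L[ℝ] E) p (P p))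

/-- `(M, g, P)` is locally Golden: `∇̆_W (P U) = P (∇̆_W U)` for all smooth vector fields. -/
def GoldenStructure.IsLocallyGolden {g : SemiRiemannianMetric E M}
    (J : GoldenStructure g) : Prop :=
  ∀ W U : ∀ p : M, TangentSpace 𝓘(ℝ, E) p, SmoothField W → SmoothField U → ∀ p,
    g.leviCivita (fun q : M ↦ q) (fun q ↦ J.P q (U q)) p (W p)
      = J.P p (g.leviCivita (fun q : M ↦ q) U p (W p))

end Ambient

section Submanifold

variable {E : Type*} [NormedAddCommGroup E] [NormedSpace ℝ E] [FiniteDimensional ℝ E]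
  {M : Type*} [TopologicalSpace M] [ChartedSpace E M] [IsManifold 𝓘(ℝ, E) ∞ M]
  {F : Type*} [NormedAddCommGroup F] [NormedSpace ℝ F] [FiniteDimensional ℝ F]
  {N : Type*} [TopologicalSpace N] [ChartedSpace F N] [IsManifold 𝓘(ℝ, F) ∞ N]

variable (E F) in
/-- The image of `T_x N` in `T_{f x} M` under the differential of `f`. -/
def tangent (f : N → M) (x : N) : Submodule ℝ (TangentSpace 𝓘(ℝ, E) (f x)) :=
  LinearMap.range (mfderiv 𝓘(ℝ, F) 𝓘(ℝ, E) f x).toLinearMap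

variable (F) in
/-- The orthogonal `T_x N^⊥` of the tangent space of the submanifold, in `T_{f x} M`. -/
def normal (g : SemiRiemannianMetric E M) (f : N → M) (x : N) :
    Submodule ℝ (TangentSpace 𝓘(ℝ, E) (f x)) :=
  (g.bilin (f x)).orthogonal (tangent E F f x)

variable (F) in
/-- The radical space `Rad T_x N = T_x N ∩ T_x N^⊥`, as a subspace of `T_x N`. -/
def rad (g : SemiRiemannianMetric E M) (f : N → M) (x : N) :
    Submodule ℝ (TangentSpace 𝓘(ℝ, F) x) :=
  (normal F g f x).comap (mfderiv 𝓘(ℝ, F) 𝓘(ℝ, E) f x).toLinearMap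

variable (F N) in
/-- A lightlike submanifold `(N, g, S(TN), S(TN^⊥))` of `(M, g)`, immersed by `f`, together with a
transversal bundle `ltr(TN)`: `Rad TN` is a smooth distribution of rank `r ≥ 1`, `S(TN)` is
complementary to it in `TN`, `S(TN^⊥)` is complementary to it in `TN^⊥`, and `ltr(TN)` is such that
`TM|_N = S(TN) ⊥ [Rad TN ⊕ ltr(TN)] ⊥ S(TN^⊥)`.
(The metric is automatically nondegenerate on `S(TN)` and on `S(TN^⊥)`, and pairs `Rad TN` with
`ltr(TN)` nondegenerately. The bundle `ltr(TN)` may be totally null, but need not be.) -/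
structure LightlikeSubmanifold (g : SemiRiemannianMetric E M) where
  /-- The immersion. -/
  f : N → M
  contMDiff : ContMDiff 𝓘(ℝ, F) 𝓘(ℝ, E) ∞ f
  injective_mfderiv : ∀ x, Function.Injective (mfderiv 𝓘(ℝ, F) 𝓘(ℝ, E) f x)
  /-- The rank of the radical distribution. -/
  r : ℕ
  one_le_r : 1 ≤ r
  finrank_rad : ∀ x, Module.finrank ℝ (rad F g f x) = r
  smooth_rad : IsSmoothSubbundle (F := F) (fun x : N ↦ x) (rad F g f)
  /-- The screen distribution `S(TN)`. -/
  screen : ∀ x : N, Submodule ℝ (TangentSpace 𝓘(ℝ, F) x)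
  smooth_screen : IsSmoothSubbundle (F := F) (fun x : N ↦ x) screen
  isCompl_screen : ∀ x, IsCompl (screen x) (rad F g f x)
  /-- The screen transversal bundle `S(TN^⊥)`. -/
  screenTr : ∀ x : N, Submodule ℝ (TangentSpace 𝓘(ℝ, E) (f x))
  smooth_screenTr : IsSmoothSubbundle (F := F) f screenTr
  disjoint_screenTr : ∀ x, Disjoint (screenTr x) (tangent E F f x ⊓ normal F g f x)
  sup_screenTr : ∀ x, screenTr x ⊔ (tangent E F f x ⊓ normal F g f x) = normal F g f x
  /-- The lightlike transversal bundle `ltr(TN)`. -/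
  ltr : ∀ x : N, Submodule ℝ (TangentSpace 𝓘(ℝ, E) (f x))
  smooth_ltr : IsSmoothSubbundle (F := F) f ltr
  ltr_orthogonal_screen : ∀ x, ∀ n ∈ ltr x, ∀ v ∈ screen x,
    g.inner (f x) n (mfderiv 𝓘(ℝ, F) 𝓘(ℝ, E) f x v) = 0
  ltr_orthogonal_screenTr : ∀ x, ∀ n ∈ ltr x, ∀ z ∈ screenTr x, g.inner (f x) n z = 0
  disjoint_ltr_screenTr : ∀ x, Disjoint (ltr x) (screenTr x)
  isCompl_tr : ∀ x, IsCompl (tangent E F f x) (ltr x ⊔ screenTr x)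

namespace LightlikeSubmanifold

variable {g : SemiRiemannianMetric E M} (L : LightlikeSubmanifold F N g)

/-- The push-forward `df(U)`, a vector field along the immersion. -/
def push (U : ∀ x : N, TangentSpace 𝓘(ℝ, F) x) (x : N) : TangentSpace 𝓘(ℝ, E) (L.f x) :=
  mfderiv 𝓘(ℝ, F) 𝓘(ℝ, E) L.f x (U x)

/-- The induced (degenerate) metric on `N`. -/
def inducedMetric (x : N) (u v : TangentSpace 𝓘(ℝ, F) x) : ℝ :=
  g.inner (L.f x) (mfderiv 𝓘(ℝ, F) 𝓘(ℝ, E) L.f x u) (mfderiv 𝓘(ℝ, F) 𝓘(ℝ, E) L.f x v)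

/-- The transversal bundle `tr(TN) = ltr(TN) ⊥ S(TN^⊥)`. -/
def tr (x : N) : Submodule ℝ (TangentSpace 𝓘(ℝ, E) (L.f x)) :=
  L.ltr x ⊔ L.screenTr x

lemma isCompl_screenTr (x : N) :
    IsCompl (L.screenTr x) (L.ltr x ⊔ tangent E F L.f x) := by
  have h : IsCompl (L.screenTr x ⊔ L.ltr x) (tangent E F L.f x) := by
    rw [sup_comm]; exact (L.isCompl_tr x).symm
  exact ⟨(L.disjoint_ltr_screenTr x).symm.disjoint_sup_right_of_disjoint_sup_left h.disjoint,
    codisjoint_assoc.mp h.codisjoint⟩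

/-- The differential of the immersion, as an isomorphism of `T_x N` onto its image. -/
def tangentEquiv (x : N) : TangentSpace 𝓘(ℝ, F) x ≃ₗ[ℝ] tangent E F L.f x :=
  LinearEquiv.ofInjective (M := TangentSpace 𝓘(ℝ, F) x)
    (mfderiv 𝓘(ℝ, F) 𝓘(ℝ, E) L.f x).toLinearMap (L.injective_mfderiv x)

/-- The tangential part: the projection `T_{f x} M = TN ⊕ tr(TN) → T_x N`. -/
def tangentialPart (x : N) : TangentSpace 𝓘(ℝ, E) (L.f x) →ₗ[ℝ] TangentSpace 𝓘(ℝ, F) x :=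
  (L.tangentEquiv x).symm.toLinearMap ∘ₗ
    (tangent E F L.f x).projectionOnto (L.tr x) (L.isCompl_tr x)

/-- The projection `T_{f x} M = TN ⊕ ltr(TN) ⊕ S(TN^⊥) → S(TN^⊥)`. -/
def screenTrPart (x : N) :
    TangentSpace 𝓘(ℝ, E) (L.f x) →ₗ[ℝ] TangentSpace 𝓘(ℝ, E) (L.f x) :=
  (L.screenTr x).projection (L.ltr x ⊔ tangent E F L.f x) (L.isCompl_screenTr x)

/-- The projection `T_{f x} M = S(TN) ⊕ Rad TN ⊕ ltr(TN) ⊕ S(TN^⊥) → S(TN)`. -/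
def screenPart (x : N) : TangentSpace 𝓘(ℝ, E) (L.f x) →ₗ[ℝ] TangentSpace 𝓘(ℝ, F) x :=
  (L.screen x).projection (rad F g L.f x) (L.isCompl_screen x) ∘ₗ L.tangentialPart x

/-- The induced connection `∇`: `∇_W U` is the tangential part of `∇̆_W U`. -/
def inducedConnection (W U : ∀ x : N, TangentSpace 𝓘(ℝ, F) x) (x : N) :
    TangentSpace 𝓘(ℝ, F) x :=
  L.tangentialPart x (g.leviCivita L.f (L.push U) x (W x))

/-- The screen second fundamental form `h^s(W, U)`: the `S(TN^⊥)`-part of `∇̆_W U`. -/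
def hs (W U : ∀ x : N, TangentSpace 𝓘(ℝ, F) x) (x : N) : TangentSpace 𝓘(ℝ, E) (L.f x) :=
  L.screenTrPart x (g.leviCivita L.f (L.push U) x (W x))

/-- `D^s(W, V)`, for a section `V` of `ltr(TN)`: the `S(TN^⊥)`-part of `∇̆_W V`. -/
def Ds (W : ∀ x : N, TangentSpace 𝓘(ℝ, F) x) (V : ∀ x : N, TangentSpace 𝓘(ℝ, E) (L.f x))
    (x : N) : TangentSpace 𝓘(ℝ, E) (L.f x) :=
  L.screenTrPart x (g.leviCivita L.f V x (W x))

/-- The induced connection is a metric connection: `∇g = 0`, that is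
`W (g(U, V)) = g(∇_W U, V) + g(U, ∇_W V)` for all smooth vector fields `W, U, V` on `N`. -/
def InducedConnectionIsMetric : Prop :=
  ∀ W U V : ∀ x : N, TangentSpace 𝓘(ℝ, F) x,
    SmoothField W → SmoothField U → SmoothField V → ∀ x,
      mvfderiv 𝓘(ℝ, F) (fun y ↦ L.inducedMetric y (U y) (V y)) x (W x)
        = L.inducedMetric x (L.inducedConnection W U x) (V x)
          + L.inducedMetric x (U x) (L.inducedConnection W V x)

/-- A transversal lightlike submanifold: `P(Rad TN) = ltr(TN)` and `P(S(TN)) ⊆ S(TN^⊥)`. -/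
structure IsTransversal (J : GoldenStructure g) : Prop where
  map_rad : ∀ x, ((rad F g L.f x).map (mfderiv 𝓘(ℝ, F) 𝓘(ℝ, E) L.f x).toLinearMap).map
    (J.P (L.f x)).toLinearMap = L.ltr x
  map_screen : ∀ x, ((L.screen x).map (mfderiv 𝓘(ℝ, F) 𝓘(ℝ, E) L.f x).toLinearMap).map
    (J.P (L.f x)).toLinearMap ≤ L.screenTr x

end LightlikeSubmanifold

end Submanifold

end GoldenLightlike

end

/-! Two facts combine. First, `∇` is metric iff `∇_W ξ` is radical for every radical field `ξ`
(`inducedConnectionIsMetric_iff`). This follows by comparing `∇g` with the metric property of `∇̆`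
along the immersion (`mvfderiv_inner`). On the transversal side it uses only that `tr(TN)` is
orthogonal to `S(TN)`.

Second, `P` is parallel also along the immersion, so `P ∇̆_W(Pξ) = P² ∇̆_W ξ = P ∇̆_W ξ + ∇̆_W ξ`.
Transversality puts `P(TN)` in `tr(TN)` and `P(ltr)` in `Rad ⊕ ltr`, so the `S(TN)`-part of `Pz`
depends only on the `S(TN^⊥)`-part of `z` (`screenPart_P_screenTrPart`). Projecting the identity to
`S(TN)` shows that the two sides of the stated condition differ exactly by the screen part of `∇_W
ξ`, which vanishes iff `∇_W ξ` is radical. -/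

namespace GoldenLightlike

open Bundle Topology

/-! ### Calculus of maps from a manifold to a normed space. -/

section ModelValued

variable {F : Type*} [NormedAddCommGroup F] [NormedSpace ℝ F]
  {N : Type*} [TopologicalSpace N] [ChartedSpace F N]
  {E G : Type*} [NormedAddCommGroup E] [NormedSpace ℝ E] [NormedAddCommGroup G] [NormedSpace ℝ G]

/-- The product rule for a family of linear maps applied to a family of vectors. -/
lemma mvfderiv_clm_apply {c : N → E →L[ℝ] G} {u : N → E} {x : N}
    (hc : MDifferentiableAt 𝓘(ℝ, F) 𝓘(ℝ, E →L[ℝ] G) c x)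
    (hu : MDifferentiableAt 𝓘(ℝ, F) 𝓘(ℝ, E) u x) (w : TangentSpace 𝓘(ℝ, F) x) :
    mvfderiv 𝓘(ℝ, F) (fun y ↦ c y (u y)) x w
      = mvfderiv 𝓘(ℝ, F) c x w (u x) + c x (mvfderiv 𝓘(ℝ, F) u x w) := by
  let c' : F →L[ℝ] E →L[ℝ] G := mvfderiv 𝓘(ℝ, F) c x
  let u' : F →L[ℝ] E := mvfderiv 𝓘(ℝ, F) u x
  have h : HasMFDerivAt 𝓘(ℝ, F) 𝓘(ℝ, G) (fun y ↦ c y (u y)) x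
      ((c x).comp u' + c'.flip (u x)) := by
    refine ⟨(hc.clm_apply hu).continuousAt, ?_⟩
    let e := extChartAt 𝓘(ℝ, F) x
    -- The extended charts of the normed-space targets are identities, so this is the Fréchet
    -- product rule read in the chart at `x`.
    have h : HasFDerivWithinAt (writtenInExtChartAt 𝓘(ℝ, F) 𝓘(ℝ, G) x fun y ↦ c y (u y))
        ((c (e.symm (e x))).comp u' + c'.flip (u (e.symm (e x)))) (Set.range 𝓘(ℝ, F)) (e x) :=
      hc.hasMFDerivAt.2.clm_apply hu.hasMFDerivAt.2
    rwa [extChartAt_to_inv] at h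
  have h' : mvfderiv 𝓘(ℝ, F) (fun y ↦ c y (u y)) x w = ((c x).comp u' + c'.flip (u x)) w := by
    rw [mvfderiv, h.mfderiv]
    rfl
  rw [h', add_comm]
  rfl

lemma mvfderiv_congr {u v : N → E} {x : N} (h : u =ᶠ[𝓝 x] v) (w : TangentSpace 𝓘(ℝ, F) x) :
    mvfderiv 𝓘(ℝ, F) u x w = mvfderiv 𝓘(ℝ, F) v x w := by
  simp only [mvfderiv, h.mfderiv_eq]
  rfl

/-- The chain rule for maps with values in a normed space. -/
lemma mvfderiv_comp_map {H : Type*} [NormedAddCommGroup H] [NormedSpace ℝ H]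
    {M : Type*} [TopologicalSpace M] [ChartedSpace H M] {c : M → G} {f : N → M} {x : N}
    (hc : MDifferentiableAt 𝓘(ℝ, H) 𝓘(ℝ, G) c (f x))
    (hf : MDifferentiableAt 𝓘(ℝ, F) 𝓘(ℝ, H) f x) (w : TangentSpace 𝓘(ℝ, F) x) :
    mvfderiv 𝓘(ℝ, F) (fun y ↦ c (f y)) x w
      = mvfderiv 𝓘(ℝ, H) c (f x) (mfderiv 𝓘(ℝ, F) 𝓘(ℝ, H) f x w) :=
  mfderiv_comp_apply x hc hf w

end ModelValued

/-! ### Vector fields in the preferred trivializations. -/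

section Ambient

variable {E : Type*} [NormedAddCommGroup E] [NormedSpace ℝ E]
  {M : Type*} [TopologicalSpace M] [ChartedSpace E M] [IsManifold 𝓘(ℝ, E) ∞ M]

local notation "τ" => trivializationAt E (TangentSpace (M := M) 𝓘(ℝ, E))

lemma eventually_mem_baseSet (p : M) : ∀ᶠ y in 𝓝 p, y ∈ (τ p).baseSet :=
  (τ p).open_baseSet.mem_nhds (FiberBundle.mem_baseSet_trivializationAt' p)

lemma symmL_trivialization {p y : M} (hy : y ∈ (τ p).baseSet) (v : TangentSpace 𝓘(ℝ, E) y) :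
    (τ p).symmL ℝ y ((τ p) (⟨y, v⟩ : TangentBundle 𝓘(ℝ, E) M)).2 = v := by
  rw [← Trivialization.continuousLinearMapAt_apply_of_mem (R := ℝ) _ hy,
    Trivialization.symmL_continuousLinearMapAt _ hy]

/-- Every tangent vector is the value of a global smooth vector field. -/
lemma exists_smoothField_eq [FiniteDimensional ℝ E] [T2Space M] (p : M)
    (v : TangentSpace 𝓘(ℝ, E) p) :
    ∃ V : ∀ y : M, TangentSpace 𝓘(ℝ, E) y, SmoothField V ∧ V p = v := by
  -- The field has constant components `c` in the trivialization at `p`, cut off by a bump function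
  -- equal to 1 at `p`.
  let ρ : SmoothBumpFunction 𝓘(ℝ, E) p := Classical.arbitrary _
  let c : E := ((τ p) (⟨p, v⟩ : TangentBundle 𝓘(ℝ, E) M)).2
  have hp := FiberBundle.mem_baseSet_trivializationAt E (TangentSpace (M := M) 𝓘(ℝ, E)) p
  refine ⟨fun y ↦ ρ y • (τ p).symmL ℝ y c, ?_, ?_⟩
  · refine ContMDiffOn.smul_section_of_tsupport (F := E) (V := TangentSpace (M := M) 𝓘(ℝ, E))
      (ψ := ρ) (u := (τ p).baseSet) ρ.contMDiff.contMDiffOn (τ p).open_baseSet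
      ?_ ?_
    · simpa using ρ.tsupport_subset_chartAt_source
    · refine (Trivialization.contMDiffOn_section_baseSet_iff (IB := 𝓘(ℝ, E)) (τ p)).2 ?_
      refine (contMDiffOn_const (c := c)).congr fun y hy ↦ ?_
      rw [← Trivialization.continuousLinearMapAt_apply_of_mem (R := ℝ) _ hy,
        Trivialization.continuousLinearMapAt_symmL _ hy]
  · simp only [ρ.eq_one, one_smul]
    exact symmL_trivialization hp v

section Along

variable {F : Type*} [NormedAddCommGroup F] [NormedSpace ℝ F]
  {N : Type*} [TopologicalSpace N] [ChartedSpace F N]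
  {f : N → M} {V : ∀ x : N, TangentSpace 𝓘(ℝ, E) (f x)}

lemma SmoothAlong.contMDiff_base (hV : SmoothAlong (F := F) f V) :
    ContMDiff 𝓘(ℝ, F) 𝓘(ℝ, E) ∞ f :=
  fun x ↦ (contMDiffAt_totalSpace.1 (hV x)).1

lemma SmoothAlong.mdifferentiableAt_base (hV : SmoothAlong (F := F) f V) (x : N) :
    MDifferentiableAt 𝓘(ℝ, F) 𝓘(ℝ, E) f x :=
  hV.contMDiff_base.mdifferentiableAt (by simp)

/-- The components of a smooth vector field along `f` in the preferred chart are smooth. -/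
lemma SmoothAlong.mdifferentiableAt_coord (hV : SmoothAlong (F := F) f V) (x : N) :
    MDifferentiableAt 𝓘(ℝ, F) 𝓘(ℝ, E)
      (fun y ↦ ((τ (f x)) (⟨f y, V y⟩ : TangentBundle 𝓘(ℝ, E) M)).2) x :=
  (contMDiffAt_totalSpace.1 (hV x)).2.mdifferentiableAt (by simp)

lemma SmoothAlong.eventually_mem_baseSet (hV : SmoothAlong (F := F) f V) (x : N) :
    ∀ᶠ y in 𝓝 x, f y ∈ (τ (f x)).baseSet :=
  hV.contMDiff_base.continuous.continuousAt.eventually (GoldenLightlike.eventually_mem_baseSet _)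

end Along

/-! ### Metric compatibility of the Levi-Civita connection along maps. -/

section Metric

variable (g : SemiRiemannianMetric E M)

lemma SemiRiemannianMetric.mdifferentiableAt_gram (p : M) :
    MDifferentiableAt 𝓘(ℝ, E) 𝓘(ℝ, E →L[ℝ] E →L[ℝ] ℝ) (g.gram p) p := by
  have h := ((contMDiffAt_totalSpace.1 (g.contMDiff p)).2).mdifferentiableAt (by simp)
  refine h.congr_of_eventuallyEq ?_
  filter_upwards [eventually_mem_baseSet (E := E) p] with y hy
  ext v w
  rw [hom_trivializationAt_apply]
  simp only [ContinuousLinearMap.inCoordinates, SemiRiemannianMetric.gram]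
  simp only [ContinuousLinearMap.comp_apply]
  rw [Trivialization.continuousLinearMapAt_apply_of_mem, hom_trivializationAt_apply]
  · simp [ContinuousLinearMap.inCoordinates]
  · simpa using hy

lemma SemiRiemannianMetric.inner_eq_gram {p y : M} (hy : y ∈ (τ p).baseSet)
    (v w : TangentSpace 𝓘(ℝ, E) y) :
    g.inner y v w = g.gram p y ((τ p) (⟨y, v⟩ : TangentBundle 𝓘(ℝ, E) M)).2
      ((τ p) (⟨y, w⟩ : TangentBundle 𝓘(ℝ, E) M)).2 := by
  simp only [gram, ContinuousLinearMap.comp_apply, ContinuousLinearMap.precomp_apply,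
    symmL_trivialization hy]

lemma SemiRiemannianMetric.inner_symmL (p : M) (a : E) (v : TangentSpace 𝓘(ℝ, E) p) :
    g.inner p ((τ p).symmL ℝ p a) v
      = g.gram p p a ((τ p) (⟨p, v⟩ : TangentBundle 𝓘(ℝ, E) M)).2 := by
  simp only [gram, ContinuousLinearMap.comp_apply, ContinuousLinearMap.precomp_apply,
    symmL_trivialization (FiberBundle.mem_baseSet_trivializationAt' p)]

lemma SemiRiemannianMetric.gram_symm (p y : M) (v w : E) : g.gram p y v w = g.gram p y w v :=
  g.symm _ _ _

lemma SemiRiemannianMetric.mvfderiv_gram_symm (p : M) (u : TangentSpace 𝓘(ℝ, E) p) (v w : E) :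
    mvfderiv 𝓘(ℝ, E) (g.gram p) p u v w = mvfderiv 𝓘(ℝ, E) (g.gram p) p u w v := by
  -- Evaluation at fixed vectors commutes with differentiation, so the symmetry of `gram` passes to
  -- its derivative.
  have key (v w : E) : mvfderiv 𝓘(ℝ, E) (fun y ↦ g.gram p y v w) p u
      = mvfderiv 𝓘(ℝ, E) (g.gram p) p u v w := by
    have h := g.mdifferentiableAt_gram p
    rw [mvfderiv_clm_apply (h.clm_apply mdifferentiableAt_const) mdifferentiableAt_const,
      mvfderiv_clm_apply h mdifferentiableAt_const]
    simp [mvfderiv_const]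
  rw [← key, ← key]
  simp only [g.gram_symm p _ v w]

variable [FiniteDimensional ℝ E]

lemma SemiRiemannianMetric.inner_christoffel (p : M) (u v w : TangentSpace 𝓘(ℝ, E) p) :
    g.inner p (g.christoffel p u v) w = g.christoffelFirst p u v w := by
  exact LinearMap.congr_fun
    (((g.bilin p).toDual (g.bilin_nondegenerate p)).apply_symm_apply (g.christoffelFirst p u v)) w

variable {F : Type*} [NormedAddCommGroup F] [NormedSpace ℝ F]
  {N : Type*} [TopologicalSpace N] [ChartedSpace F N]
  {f : N → M} {U V : ∀ x : N, TangentSpace 𝓘(ℝ, E) (f x)}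

lemma SemiRiemannianMetric.inner_leviCivita (f : N → M)
    (U : ∀ x : N, TangentSpace 𝓘(ℝ, E) (f x)) (x : N) (w : TangentSpace 𝓘(ℝ, F) x)
    (v : TangentSpace 𝓘(ℝ, E) (f x)) :
    g.inner (f x) (g.leviCivita f U x w) v
      = g.gram (f x) (f x) (mvfderiv 𝓘(ℝ, F)
          (fun y ↦ ((τ (f x)) (⟨f y, U y⟩ : TangentBundle 𝓘(ℝ, E) M)).2) x w)
          ((τ (f x)) (⟨f x, v⟩ : TangentBundle 𝓘(ℝ, E) M)).2
        + g.christoffelFirst (f x) (mfderiv 𝓘(ℝ, F) 𝓘(ℝ, E) f x w) (U x) v := by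
  rw [leviCivita, map_add, add_apply, g.inner_symmL, g.inner_christoffel]

/-- The Levi-Civita connection is metric, also for vector fields along a map. -/
theorem SemiRiemannianMetric.mvfderiv_inner (hU : SmoothAlong (F := F) f U)
    (hV : SmoothAlong (F := F) f V) (x : N) (w : TangentSpace 𝓘(ℝ, F) x) :
    mvfderiv 𝓘(ℝ, F) (fun y ↦ g.inner (f y) (U y) (V y)) x w
      = g.inner (f x) (g.leviCivita f U x w) (V x)
        + g.inner (f x) (U x) (g.leviCivita f V x w) := by
  have hG := g.mdifferentiableAt_gram (f x)
  have hf := hU.mdifferentiableAt_base x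
  have hGf : MDifferentiableAt 𝓘(ℝ, F) 𝓘(ℝ, E →L[ℝ] E →L[ℝ] ℝ) (fun y ↦ g.gram (f x) (f y)) x :=
    hG.comp x hf
  have hx : f x ∈ (τ (f x)).baseSet := FiberBundle.mem_baseSet_trivializationAt' _
  have hU' := hU.mdifferentiableAt_coord x
  have hV' := hV.mdifferentiableAt_coord x
  have h₁ : mvfderiv 𝓘(ℝ, F) (fun y ↦ g.inner (f y) (U y) (V y)) x w
      = mvfderiv 𝓘(ℝ, F) (fun y ↦ g.gram (f x) (f y)
        ((τ (f x)) (⟨f y, U y⟩ : TangentBundle 𝓘(ℝ, E) M)).2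
        ((τ (f x)) (⟨f y, V y⟩ : TangentBundle 𝓘(ℝ, E) M)).2) x w := by
    refine mvfderiv_congr ?_ w
    filter_upwards [hU.eventually_mem_baseSet x] with y hy
    exact g.inner_eq_gram hy _ _
  rw [h₁, mvfderiv_clm_apply (hGf.clm_apply hU') hV', mvfderiv_clm_apply hGf hU',
    mvfderiv_comp_map hG hf, add_apply, g.symm _ (U x), g.inner_leviCivita, g.inner_leviCivita,
    g.gram_symm _ _ _ (mvfderiv 𝓘(ℝ, F) _ x w)]
  simp only [christoffelFirst, LinearMap.coe_mk, AddHom.coe_mk,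
    Trivialization.continuousLinearMapAt_apply_of_mem (R := ℝ) _ hx]
  -- In `Γ(w, U, V) + Γ(w, V, U)` the terms differentiating along `U` and `V` cancel; by symmetry
  -- what remains is `∂_w g(U, V)`.
  linarith [g.mvfderiv_gram_symm (f x) (mfderiv 𝓘(ℝ, F) 𝓘(ℝ, E) f x w)
    ((τ (f x)) (⟨f x, U x⟩ : TangentBundle 𝓘(ℝ, E) M)).2
    ((τ (f x)) (⟨f x, V x⟩ : TangentBundle 𝓘(ℝ, E) M)).2]

end Metric

/-! ### Parallelism of the Golden structure along maps. -/

section Golden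

variable {g : SemiRiemannianMetric E M} (J : GoldenStructure g)

/-- The coordinate matrix of `P` in the preferred chart at `p`. -/
noncomputable def GoldenStructure.coord (p y : M) : E →L[ℝ] E :=
  (τ p).continuousLinearMapAt ℝ y ∘L J.P y ∘L (τ p).symmL ℝ y

lemma GoldenStructure.mdifferentiableAt_coord (p : M) :
    MDifferentiableAt 𝓘(ℝ, E) 𝓘(ℝ, E →L[ℝ] E) (J.coord p) p :=
  ((contMDiffAt_totalSpace.1 (J.contMDiff p)).2).mdifferentiableAt (by simp)

lemma GoldenStructure.coord_trivialization {p y : M} (hy : y ∈ (τ p).baseSet)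
    (v : TangentSpace 𝓘(ℝ, E) y) :
    ((τ p) (⟨y, J.P y v⟩ : TangentBundle 𝓘(ℝ, E) M)).2
      = J.coord p y ((τ p) (⟨y, v⟩ : TangentBundle 𝓘(ℝ, E) M)).2 := by
  simp only [coord, ContinuousLinearMap.comp_apply, symmL_trivialization hy,
    Trivialization.continuousLinearMapAt_apply_of_mem (R := ℝ) _ hy]

lemma GoldenStructure.symmL_coord {p : M} (v : E) :
    (τ p).symmL ℝ p (J.coord p p v) = J.P p ((τ p).symmL ℝ p v) := by
  simp only [coord, ContinuousLinearMap.comp_apply]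
  rw [Trivialization.symmL_continuousLinearMapAt _ (FiberBundle.mem_baseSet_trivializationAt' p)]

variable {F : Type*} [NormedAddCommGroup F] [NormedSpace ℝ F]
  {N : Type*} [TopologicalSpace N] [ChartedSpace F N]
  {f : N → M} {V : ∀ x : N, TangentSpace 𝓘(ℝ, E) (f x)}

lemma GoldenStructure.smoothAlong (hV : SmoothAlong (F := F) f V) :
    SmoothAlong (F := F) f (fun y ↦ J.P (f y) (V y)) :=
  ContMDiff.clm_bundle_apply (E₁ := TangentSpace (M := M) 𝓘(ℝ, E))
    (E₂ := TangentSpace (M := M) 𝓘(ℝ, E)) (J.contMDiff.comp hV.contMDiff_base) hV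

variable [FiniteDimensional ℝ E]

/-- The covariant derivative `(∇̆_u P) v`, in the preferred chart at `p`. -/
noncomputable def GoldenStructure.covDeriv (p : M) (u v : TangentSpace 𝓘(ℝ, E) p) :
    TangentSpace 𝓘(ℝ, E) p :=
  (τ p).symmL ℝ p (mvfderiv 𝓘(ℝ, E) (J.coord p) p u
      ((τ p) (⟨p, v⟩ : TangentBundle 𝓘(ℝ, E) M)).2)
    + g.christoffel p u (J.P p v) - J.P p (g.christoffel p u v)

/-- The Leibniz rule for `P` applied to a vector field along a map. -/
lemma GoldenStructure.leviCivita_apply (hV : SmoothAlong (F := F) f V) (x : N)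
    (w : TangentSpace 𝓘(ℝ, F) x) :
    g.leviCivita f (fun y ↦ J.P (f y) (V y)) x w
      = J.covDeriv (f x) (mfderiv 𝓘(ℝ, F) 𝓘(ℝ, E) f x w) (V x)
        + J.P (f x) (g.leviCivita f V x w) := by
  have hP := J.mdifferentiableAt_coord (f x)
  have hf := hV.mdifferentiableAt_base x
  have hPf : MDifferentiableAt 𝓘(ℝ, F) 𝓘(ℝ, E →L[ℝ] E) (fun y ↦ J.coord (f x) (f y)) x :=
    hP.comp x hf
  have h₁ : mvfderiv 𝓘(ℝ, F)
        (fun y ↦ ((τ (f x)) (⟨f y, J.P (f y) (V y)⟩ : TangentBundle 𝓘(ℝ, E) M)).2) x w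
      = mvfderiv 𝓘(ℝ, F) (fun y ↦ J.coord (f x) (f y)
        ((τ (f x)) (⟨f y, V y⟩ : TangentBundle 𝓘(ℝ, E) M)).2) x w := by
    refine mvfderiv_congr ?_ w
    filter_upwards [hV.eventually_mem_baseSet x] with y hy
    exact J.coord_trivialization hy _
  simp only [SemiRiemannianMetric.leviCivita, h₁]
  rw [mvfderiv_clm_apply hPf (hV.mdifferentiableAt_coord x), mvfderiv_comp_map hP hf]
  simp only [covDeriv, map_add, J.symmL_coord]
  abel

/-- `∇̆P` is tensorial and any two vectors at `p` extend to global smooth fields, so the hypothesis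
on fields of `M` forces pointwise vanishing. The pointwise form is what transfers to fields defined
only along the immersion. -/
lemma GoldenStructure.IsLocallyGolden.covDeriv_eq_zero [T2Space M] {J : GoldenStructure g}
    (hJ : J.IsLocallyGolden) (p : M) (u v : TangentSpace 𝓘(ℝ, E) p) : J.covDeriv p u v = 0 := by
  obtain ⟨U, hU, rfl⟩ := exists_smoothField_eq p u
  obtain ⟨V, hV, rfl⟩ := exists_smoothField_eq p v
  have h := J.leviCivita_apply (f := fun q : M ↦ q) hV p (U p)
  rw [hJ U V hU hV p] at h
  have hid : mfderiv 𝓘(ℝ, E) 𝓘(ℝ, E) (fun q : M ↦ q) p (U p) = U p := by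
    rw [show (fun q : M ↦ q) = id from rfl, mfderiv_id]
    rfl
  rw [hid] at h
  simpa using h

/-- On a locally Golden manifold, `P` commutes with covariant derivatives along maps. -/
theorem GoldenStructure.IsLocallyGolden.leviCivita_apply [T2Space M] {J : GoldenStructure g}
    (hJ : J.IsLocallyGolden) (hV : SmoothAlong (F := F) f V) (x : N)
    (w : TangentSpace 𝓘(ℝ, F) x) :
    g.leviCivita f (fun y ↦ J.P (f y) (V y)) x w = J.P (f x) (g.leviCivita f V x w) := by
  rw [J.leviCivita_apply hV, hJ.covDeriv_eq_zero, zero_add]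

end Golden

end Ambient
end GoldenLightlike

namespace GoldenLightlike
namespace LightlikeSubmanifold

variable {E : Type*} [NormedAddCommGroup E] [NormedSpace ℝ E]
  {M : Type*} [TopologicalSpace M] [ChartedSpace E M] [IsManifold 𝓘(ℝ, E) ∞ M]
  {F : Type*} [NormedAddCommGroup F] [NormedSpace ℝ F]
  {N : Type*} [TopologicalSpace N] [ChartedSpace F N] [IsManifold 𝓘(ℝ, F) ∞ N]
  {g : SemiRiemannianMetric E M} (L : LightlikeSubmanifold F N g)

local notation "df" => mfderiv 𝓘(ℝ, F) 𝓘(ℝ, E) L.f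

lemma smoothAlong_push {U : ∀ x : N, TangentSpace 𝓘(ℝ, F) x} (hU : SmoothField U) :
    SmoothAlong (F := F) L.f (L.push U) :=
  (L.contMDiff.contMDiff_tangentMap (m := ∞) (by simp)).comp hU

/-! ### Projections attached to the splitting of the ambient tangent bundle. -/

section Projections

lemma tangentialPart_mfderiv (x : N) (v : TangentSpace 𝓘(ℝ, F) x) :
    L.tangentialPart x (df x v) = v := by
  have h : (tangent E F L.f x).projectionOnto (L.tr x) (L.isCompl_tr x) (df x v)
      = L.tangentEquiv x v :=
    Submodule.projectionOnto_apply_of_mem_left _ (LinearMap.mem_range_self _ v)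
  rw [tangentialPart, LinearMap.comp_apply, h]
  exact (L.tangentEquiv x).symm_apply_apply v

lemma tangentialPart_of_mem_tr {x : N} {z : TangentSpace 𝓘(ℝ, E) (L.f x)} (hz : z ∈ L.tr x) :
    L.tangentialPart x z = 0 := by
  have h : (tangent E F L.f x).projectionOnto (L.tr x) (L.isCompl_tr x) z = 0 :=
    Submodule.projectionOnto_apply_of_mem_right (L.isCompl_tr x) hz
  exact (congrArg (L.tangentEquiv x).symm h).trans (map_zero _)

lemma screenPart_eq_zero_iff {x : N} {z : TangentSpace 𝓘(ℝ, E) (L.f x)} :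
    L.screenPart x z = 0 ↔ L.tangentialPart x z ∈ rad F g L.f x := by
  rw [screenPart, LinearMap.comp_apply, Submodule.projection_apply_eq_zero_iff]

lemma screenPart_of_mem_tr {x : N} {z : TangentSpace 𝓘(ℝ, E) (L.f x)} (hz : z ∈ L.tr x) :
    L.screenPart x z = 0 := by
  rw [screenPart_eq_zero_iff, L.tangentialPart_of_mem_tr hz]
  exact zero_mem _

lemma screenPart_mfderiv_of_mem_rad {x : N} {v : TangentSpace 𝓘(ℝ, F) x}
    (hv : v ∈ rad F g L.f x) : L.screenPart x (df x v) = 0 := by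
  rwa [screenPart_eq_zero_iff, L.tangentialPart_mfderiv]

variable [FiniteDimensional ℝ E] [FiniteDimensional ℝ F]

/-- `tangentialPart` and `screenTrPart` come from different complementary pairs; a single splitting
along `TN ⊕ ltr ⊕ S(TN^⊥)` computes both. -/
lemma exists_decomposition (x : N) (z : TangentSpace 𝓘(ℝ, E) (L.f x)) :
    ∃ n ∈ L.ltr x, ∃ s ∈ L.screenTr x, z = df x (L.tangentialPart x z) + n + s ∧
      L.screenTrPart x z = s := by
  obtain ⟨t, ⟨v, rfl⟩, m, hm, rfl⟩ :=
    Submodule.mem_sup.1 ((L.isCompl_tr x).sup_eq_top ▸ Submodule.mem_top (x := z))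
  obtain ⟨n, hn, s, hs, rfl⟩ := Submodule.mem_sup.1 hm
  refine ⟨n, hn, s, hs, ?_, ?_⟩
  · rw [map_add, L.tangentialPart_of_mem_tr hm, add_zero, add_assoc]
    congr 1
    exact (congrArg _ (L.tangentialPart_mfderiv x v)).symm
  · have h : (mfderiv 𝓘(ℝ, F) 𝓘(ℝ, E) L.f x).toLinearMap v + n ∈ L.ltr x ⊔ tangent E F L.f x :=
      add_comm n _ ▸ Submodule.add_mem_sup hn (LinearMap.mem_range_self _ v)
    rw [← add_assoc, map_add, screenTrPart, Submodule.projection_apply_of_mem_right _ h, zero_add,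
      Submodule.projection_apply_of_mem_left _ hs]

end Projections

/-! ### Metric induced connections and the radical distribution. -/

section Metric

lemma inner_mfderiv_of_mem_rad {x : N} {v : TangentSpace 𝓘(ℝ, F) x} (hv : v ∈ rad F g L.f x)
    (u : TangentSpace 𝓘(ℝ, F) x) : g.inner (L.f x) (df x u) (df x v) = 0 :=
  hv _ (LinearMap.mem_range_self _ u)

lemma inner_mfderiv_of_mem_rad' {x : N} {v : TangentSpace 𝓘(ℝ, F) x} (hv : v ∈ rad F g L.f x)
    (u : TangentSpace 𝓘(ℝ, F) x) : g.inner (L.f x) (df x v) (df x u) = 0 := by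
  rw [g.symm, L.inner_mfderiv_of_mem_rad hv]

variable [FiniteDimensional ℝ E] [FiniteDimensional ℝ F]

/-- The transversal bundle is orthogonal to the screen distribution. -/
lemma inner_mfderiv_of_mem_screen {x : N} (z : TangentSpace 𝓘(ℝ, E) (L.f x))
    {s : TangentSpace 𝓘(ℝ, F) x} (hs : s ∈ L.screen x) :
    g.inner (L.f x) z (df x s) = L.inducedMetric x (L.tangentialPart x z) s := by
  obtain ⟨n, hn, t, ht, hz, -⟩ := L.exists_decomposition x z
  have ht' : t ∈ normal F g L.f x := L.sup_screenTr x ▸ Submodule.mem_sup_left ht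
  have h : g.inner (L.f x) t (df x s) = 0 :=
    (g.symm _ _ _).trans (ht' _ (LinearMap.mem_range_self _ s))
  conv_lhs => rw [hz]
  rw [map_add, map_add, add_apply, add_apply, L.ltr_orthogonal_screen x n hn s hs, h, add_zero,
    add_zero, inducedMetric]

/-- The induced connection is metric if and only if it preserves the radical distribution. -/
theorem inducedConnectionIsMetric_iff [T2Space N] :
    L.InducedConnectionIsMetric ↔
      ∀ W ξ : ∀ x : N, TangentSpace 𝓘(ℝ, F) x, SmoothField W → SmoothField ξ →
        (∀ x, ξ x ∈ rad F g L.f x) → ∀ x, L.inducedConnection W ξ x ∈ rad F g L.f x := by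
  constructor
  · rintro h W ξ hW hξ hrad x _ ⟨u, rfl⟩
    obtain ⟨U, hU, rfl⟩ := exists_smoothField_eq x u
    -- Since `g(·, ξ)` vanishes identically, only `g(U, ∇_W ξ)` survives in `∇g = 0`, and it must be
    -- zero.
    have key := h W U ξ hW hU hξ x
    have h₀ (y : N) (v : TangentSpace 𝓘(ℝ, F) y) : L.inducedMetric y v (ξ y) = 0 :=
      L.inner_mfderiv_of_mem_rad (hrad y) v
    simp only [h₀, zero_add] at key
    refine key.symm.trans ?_
    change mvfderiv 𝓘(ℝ, F) (fun _ : N ↦ (0 : ℝ)) x (W x) = 0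
    simp [mvfderiv_const]
  · intro h W U V hW hU hV x
    -- Differentiate `g(A, ζ) = 0`, valid everywhere because `ζ` is radical.
    have orth {A ζ : ∀ y : N, TangentSpace 𝓘(ℝ, F) y} (hA : SmoothField A) (hζ : SmoothField ζ)
        (hrad : ∀ y, ζ y ∈ rad F g L.f y) :
        g.inner (L.f x) (g.leviCivita L.f (L.push A) x (W x)) (df x (ζ x))
          + g.inner (L.f x) (df x (A x)) (g.leviCivita L.f (L.push ζ) x (W x)) = 0 := by
      refine (g.mvfderiv_inner (L.smoothAlong_push hA) (L.smoothAlong_push hζ) x (W x)).symm.trans ?_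
      have h₀ (y : N) : g.inner (L.f y) (L.push A y) (L.push ζ y) = 0 :=
        L.inner_mfderiv_of_mem_rad (hrad y) _
      simp [h₀, mvfderiv_const]
    -- Only the radical part is differentiated later, so it is extended to a smooth section; the
    -- screen part is needed at `x` alone.
    have split (A : ∀ y : N, TangentSpace 𝓘(ℝ, F) y) : ∃ ζ : ∀ y : N, TangentSpace 𝓘(ℝ, F) y,
        SmoothField ζ ∧ (∀ y, ζ y ∈ rad F g L.f y) ∧ ∃ s ∈ L.screen x, A x = s + ζ x := by
      obtain ⟨s, hs, ρ, hρ, hA⟩ := Submodule.mem_sup.1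
        ((L.isCompl_screen x).sup_eq_top ▸ Submodule.mem_top (x := A x))
      obtain ⟨ζ, hζ, hrad, rfl⟩ := L.smooth_rad.exists_section x ρ hρ
      exact ⟨ζ, hζ, hrad, s, hs, hA.symm⟩
    obtain ⟨ξ, hξ, hξr, s, hs, hUs⟩ := split U
    obtain ⟨η, hη, hηr, t, ht, hVt⟩ := split V
    have e₁ := orth hU hη hηr
    have e₂ := orth hV hξ hξr
    have e₃ := orth hξ hη hηr
    -- Here the hypothesis enters: the tangential part of `∇̆_W ζ` is radical and its transversal
    -- part is orthogonal to the screen.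
    have zero {ζ : ∀ y : N, TangentSpace 𝓘(ℝ, F) y} (hζ : SmoothField ζ)
        (hrad : ∀ y, ζ y ∈ rad F g L.f y) {r : TangentSpace 𝓘(ℝ, F) x} (hr : r ∈ L.screen x) :
        g.inner (L.f x) (df x r) (g.leviCivita L.f (L.push ζ) x (W x)) = 0 := by
      rw [g.symm, L.inner_mfderiv_of_mem_screen _ hr]
      exact L.inner_mfderiv_of_mem_rad' (h W ζ hW hζ hrad x) r
    have z₁ := zero hη hηr hs
    have z₂ := zero hξ hξr ht
    have a₁ := L.inner_mfderiv_of_mem_screen (g.leviCivita L.f (L.push U) x (W x)) ht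
    have a₂ := L.inner_mfderiv_of_mem_screen (g.leviCivita L.f (L.push V) x (W x)) hs
    have b₁ := L.inner_mfderiv_of_mem_rad (hηr x) (L.inducedConnection W U x)
    have b₂ := L.inner_mfderiv_of_mem_rad (hξr x) (L.inducedConnection W V x)
    refine (g.mvfderiv_inner (L.smoothAlong_push hU) (L.smoothAlong_push hV) x (W x)).trans ?_
    simp only [push, inducedMetric, inducedConnection] at *
    rw [hUs, map_add, map_add, add_apply, z₁] at e₁
    rw [hVt, map_add, map_add, add_apply, z₂] at e₂
    rw [hUs, hVt, g.symm _ _ (g.leviCivita L.f _ x (W x)),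
      g.symm _ _ (df x (L.tangentialPart x (g.leviCivita L.f _ x (W x))))]
    simp only [map_add, a₁, a₂, b₁, b₂]
    -- With `U = s + ξ` and `V = t + η` at `x`, what remains is `g(∇̆_W U, η) + g(∇̆_W V, ξ) = 0`,
    -- which is `e₁ + e₂ - e₃`.
    linarith [g.symm (L.f x) (df x (η x)) (g.leviCivita L.f (L.push ξ) x (W x))]

end Metric

/-! ### The action of `P` on a transversal lightlike submanifold. -/

section Transversal

variable {L} {J : GoldenStructure g}

lemma IsTransversal.P_mem_ltr (hL : L.IsTransversal J) {x : N} {v : TangentSpace 𝓘(ℝ, F) x}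
    (hv : v ∈ rad F g L.f x) : J.P (L.f x) (df x v) ∈ L.ltr x :=
  hL.map_rad x ▸ Submodule.mem_map_of_mem (Submodule.mem_map_of_mem hv)

lemma IsTransversal.P_mem_tr (hL : L.IsTransversal J) {x : N} (v : TangentSpace 𝓘(ℝ, F) x) :
    J.P (L.f x) (df x v) ∈ L.tr x := by
  obtain ⟨s, hs, ρ, hρ, rfl⟩ := Submodule.mem_sup.1
    ((L.isCompl_screen x).sup_eq_top ▸ Submodule.mem_top (x := v))
  rw [map_add, map_add]
  exact add_mem (Submodule.mem_sup_right <| hL.map_screen x <|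
    Submodule.mem_map_of_mem (Submodule.mem_map_of_mem hs))
    (Submodule.mem_sup_left <| hL.P_mem_ltr hρ)

/-- Writing `n = Pρ` with `ρ` radical gives `Pn = P²ρ = Pρ + ρ`, which lies in `ltr ⊕ Rad` and has
no screen component. -/
lemma IsTransversal.screenPart_P_of_mem_ltr (hL : L.IsTransversal J) {x : N}
    {n : TangentSpace 𝓘(ℝ, E) (L.f x)} (hn : n ∈ L.ltr x) :
    L.screenPart x (J.P (L.f x) n) = 0 := by
  rw [← hL.map_rad x] at hn
  obtain ⟨_, ⟨ρ, hρ, rfl⟩, rfl⟩ := hn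
  have h : L.screenPart x (J.P (L.f x) (df x ρ) + df x ρ) = 0 := by
    rw [map_add, L.screenPart_of_mem_tr (hL.P_mem_tr ρ), L.screenPart_mfderiv_of_mem_rad hρ,
      add_zero]
  exact (congrArg _ (J.golden (L.f x) (df x ρ))).trans h

variable [FiniteDimensional ℝ E] [FiniteDimensional ℝ F]

/-- Only the `S(TN^⊥)`-part of a vector contributes to the `S(TN)`-part of its image under `P`. -/
lemma IsTransversal.screenPart_P_screenTrPart (hL : L.IsTransversal J) {x : N}
    (z : TangentSpace 𝓘(ℝ, E) (L.f x)) :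
    L.screenPart x (J.P (L.f x) (L.screenTrPart x z)) = L.screenPart x (J.P (L.f x) z) := by
  obtain ⟨n, hn, s, hs, hz, h⟩ := L.exists_decomposition x z
  rw [h]
  conv_rhs => rw [hz]
  rw [map_add, map_add, map_add, map_add, L.screenPart_of_mem_tr (hL.P_mem_tr _),
    hL.screenPart_P_of_mem_ltr hn, zero_add, zero_add]

end Transversal

end LightlikeSubmanifold
end GoldenLightlike

/-! ### The characterization of metric induced connections. -/

theorem mainTheorem2
    {E : Type*} [NormedAddCommGroup E] [NormedSpace ℝ E] [FiniteDimensional ℝ E]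
    {M : Type*} [TopologicalSpace M] [T2Space M] [SecondCountableTopology M]
    [ChartedSpace E M] [IsManifold 𝓘(ℝ, E) ∞ M]
    {F : Type*} [NormedAddCommGroup F] [NormedSpace ℝ F] [FiniteDimensional ℝ F]
    {N : Type*} [TopologicalSpace N] [T2Space N] [SecondCountableTopology N]
    [ChartedSpace F N] [IsManifold 𝓘(ℝ, F) ∞ N]
    (g : GoldenLightlike.SemiRiemannianMetric E M) (J : GoldenLightlike.GoldenStructure g)
    (hJ : J.IsLocallyGolden)
    (L : GoldenLightlike.LightlikeSubmanifold F N g) (hL : L.IsTransversal J) :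
    L.InducedConnectionIsMetric ↔
      ∀ W ξ : ∀ x : N, TangentSpace 𝓘(ℝ, F) x,
        GoldenLightlike.SmoothField W → GoldenLightlike.SmoothField ξ →
        (∀ x, ξ x ∈ GoldenLightlike.rad F g L.f x) →
        ∀ x : N,
          L.screenPart x (J.P (L.f x) (L.Ds W (fun y ↦ J.P (L.f y) (L.push ξ y)) x))
            = L.screenPart x (J.P (L.f x) (L.hs W ξ x)) := by
  rw [L.inducedConnectionIsMetric_iff]
  refine forall₄_congr fun W ξ hW hξ ↦ forall₂_congr fun hrad x ↦ ?_
  -- Both sides become screen parts of full covariant derivatives. By `P² = P + I` the left side is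
  -- the right side plus the screen part of `∇̆_W ξ`, so equality means that this last term
  -- vanishes.
  rw [GoldenLightlike.LightlikeSubmanifold.Ds, GoldenLightlike.LightlikeSubmanifold.hs,
    hL.screenPart_P_screenTrPart, hL.screenPart_P_screenTrPart,
    hJ.leviCivita_apply (L.smoothAlong_push hξ), J.golden, map_add, add_eq_left,
    L.screenPart_eq_zero_iff]
  rfl
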